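/- Let $A$ be a set (the alphabet), let $A^*$ be the free monoid of words over $A$, with empty word $\epsilon$, and for $X\subseteq A^*$ let $X^*$ be the submonoid generated by $X$. A submonoid $M$ of $A^*$ that is generated by at most $k$ nonempty words is called $k$-maximal if $M\subseteq M'$ implies $M=M'$ for every submonoid $M'$ generated by at most $k$ nonempty words. The minimal generating set of $M$ is $(M\setminus\{\epsilon\})\setminus(M\setminus\{\epsilon\})^2$; $M$ is free if each of its words is a product of elements of this set in exactly one way, and the set is then called the basis of $M$. A finite set $X\subseteq A^*$ is primitive if it is the basis of an $|X|$-maximal submonoid; a primitive pair is a primitive set with exactly two elements. Let $\theta\colon A^*\to A^*$ be an involutive morphism, that is, a monoid morphism with $\theta(\theta(a))=a$ for every $a\in A$. A word $w$ is a $\theta$-power of a word $t$ if $w\in t\{t,\theta(t)\}^*$, and $w$ is $\theta$-primitive if it is not a $\theta$-power of any nonempty word $t$ with $|t|<|w|$. Then: 1. for every nonempty word $w$, $w$ is $\theta$-primitive if and only if the set $\{w,\theta(w)\}$ is primitive; 2. for every word $w$ with $\theta(w)\neq w$, $w$ is $\theta$-primitive if and only if $\{w,\theta(w)\}$ is a primitive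 pair; 3. for every word $w$ there is a unique $\theta$-primitive word $u$ (the $\theta$-root of $w$) such that $w$ is a $\theta$-power of $u$. -/

import Mathlib

namespace WordComb

variable {A : Type*}

/-- The minimal generating set `(M \ {ε}) \ (M \ {ε})²` of a submonoid `M` of the free monoid. -/
def minGen (M : Submonoid (FreeMonoid A)) : Set (FreeMonoid A) :=
  {x | x ∈ M ∧ x ≠ 1 ∧ ¬ ∃ u ∈ M, ∃ v ∈ M, u ≠ 1 ∧ v ≠ 1 ∧ x = u * v}

/-- `M` is free: every word of `M` is in a unique way a product of elements of its minimal
generating set. -/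
def IsFreeSubmonoid (M : Submonoid (FreeMonoid A)) : Prop :=
  ∀ w ∈ M, ∃! l : List (FreeMonoid A), (∀ x ∈ l, x ∈ minGen M) ∧ l.prod = w

/-- `X` is the basis of `M`: `M` is free and `X` is its minimal generating set. -/
def IsBasisOf (X : Set (FreeMonoid A)) (M : Submonoid (FreeMonoid A)) : Prop :=
  IsFreeSubmonoid M ∧ X = minGen M

/-- `M` is generated by at most `k` nonempty words. -/
def GeneratedByAtMost (k : ℕ) (M : Submonoid (FreeMonoid A)) : Prop :=
  ∃ Y : Set (FreeMonoid A), Y.Finite ∧ Y.ncard ≤ k ∧ (1 : FreeMonoid A) ∉ Y ∧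
    Submonoid.closure Y = M

/-- `M` is a `k`-maximal submonoid: it is maximal for inclusion among the submonoids generated
by at most `k` nonempty words. -/
def IsKMaximal (k : ℕ) (M : Submonoid (FreeMonoid A)) : Prop :=
  GeneratedByAtMost k M ∧
    ∀ M' : Submonoid (FreeMonoid A), GeneratedByAtMost k M' → M ≤ M' → M = M'

/-- A finite set of words is primitive if it is the basis of an `|X|`-maximal submonoid. -/
def IsPrimitiveSet (X : Set (FreeMonoid A)) : Prop :=
  X.Finite ∧ ∃ M : Submonoid (FreeMonoid A), IsKMaximal X.ncard M ∧ IsBasisOf X M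

/-- A primitive pair is a primitive set of cardinality two. -/
def IsPrimitivePair (X : Set (FreeMonoid A)) : Prop :=
  IsPrimitiveSet X ∧ X.ncard = 2

/-- An endomorphism of `A*` is an involution if `θ (θ a) = a` for every letter `a`. -/
def IsInvolutive (θ : FreeMonoid A →* FreeMonoid A) : Prop :=
  ∀ a : A, θ (θ (FreeMonoid.of a)) = FreeMonoid.of a

/-- `w` is a `θ`-power of `t`, that is, `w ∈ t {t, θ(t)}*`. -/
def IsThetaPower (θ : FreeMonoid A →* FreeMonoid A) (w t : FreeMonoid A) : Prop :=
  ∃ s ∈ Submonoid.closure ({t, θ t} : Set (FreeMonoid A)), w = t * s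

/-- `w` is `θ`-primitive: it is not a `θ`-power of a shorter nonempty word. -/
def IsThetaPrimitive (θ : FreeMonoid A →* FreeMonoid A) (w : FreeMonoid A) : Prop :=
  ¬ ∃ t : FreeMonoid A, t ≠ 1 ∧ IsThetaPower θ w t ∧ t.length < w.length

end WordComb

/-! A θ-invariant form of the defect theorem carries everything (`exists_common_isThetaPower`). If
`x * s = y * t` over `{x, θ x, y, θ y}`, the free hull of these four words is θ-invariant, and in it
`x` and `y` begin with the same minimal generator `p`. Every minimal generator of the hull begins
one of the four words, so only `p` and `θ p` occur. Two θ-roots of a nonempty word satisfy such a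
relation, hence coincide. If `{w, θ w}` lies in `Y*` with `|Y| ≤ 2` and `θ w ≠ w`, comparing the
factorizations of `w` and `θ (θ w)` gives such a relation between `x` and `θ y`, where `Y = {x, y}`;
thus `Y* ⊆ {p, θ p}*`, and θ-primitivity of `w` closes the chain. Conversely, a shorter θ-root would
generate a strictly larger submonoid. -/

namespace WordComb

section Words

variable {A : Type*}

theorem length_pos_of_ne_one {w : FreeMonoid A} (hw : w ≠ 1) : 0 < w.length :=
  Nat.pos_of_ne_zero fun h => hw (FreeMonoid.length_eq_zero.1 h)

/-- Two factorizations of a word: the shorter left factor is a prefix of the longer one. -/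
theorem exists_eq_mul_of_mul_eq_mul {a b c d : FreeMonoid A} (h : a * b = c * d)
    (hl : a.length ≤ c.length) : ∃ r, c = a * r ∧ b = r * d := by
  have h' : a.toList ++ b.toList = c.toList ++ d.toList := h
  rcases List.append_eq_append_iff.1 h' with ⟨r, h1, h2⟩ | ⟨r, h1, h2⟩
  · exact ⟨FreeMonoid.ofList r, h1, h2⟩
  · have hr : r = [] := by
      have h3 := congrArg List.length h1
      rw [List.length_append] at h3
      have h4 : a.toList.length ≤ c.toList.length := hl
      exact List.length_eq_zero_iff.1 (by omega)
    subst hr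
    refine ⟨1, ?_, ?_⟩
    · rw [mul_one]
      exact (by simpa using h1.symm : c.toList = a.toList)
    · rw [one_mul]
      exact (by simpa using h2.symm : b.toList = d.toList)

theorem eq_and_eq_of_mul_eq_mul {a b c d : FreeMonoid A} (h : a * b = c * d)
    (hl : a.length = c.length) : a = c ∧ b = d := by
  obtain ⟨r, rfl, rfl⟩ := exists_eq_mul_of_mul_eq_mul h hl.le
  rw [FreeMonoid.length_mul] at hl
  have hr : r = 1 := FreeMonoid.length_eq_zero.1 (by omega)
  simp [hr]

theorem exists_mul_of_mem_closure {X : Set (FreeMonoid A)} {w : FreeMonoid A}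
    (hw : w ∈ Submonoid.closure X) (h1 : w ≠ 1) :
    ∃ g ∈ X, g ≠ 1 ∧ ∃ h ∈ Submonoid.closure X, w = g * h := by
  induction hw using Submonoid.closure_induction_left with
  | one => exact absurd rfl h1
  | mul_left x hx y hy ih =>
    by_cases hx1 : x = 1
    · subst hx1
      rw [one_mul] at h1 ⊢
      exact ih h1
    · exact ⟨x, hx, hx1, y, hy, rfl⟩

theorem exists_minGen_mul {M : Submonoid (FreeMonoid A)} :
    ∀ (n : ℕ) (w : FreeMonoid A), w.length = n → w ∈ M → w ≠ 1 →
      ∃ b ∈ minGen M, ∃ h ∈ M, w = b * h := by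
  intro n
  induction n using Nat.strong_induction_on with
  | _ n ih =>
    intro w hn hw h1
    by_cases hb : w ∈ minGen M
    · exact ⟨w, hb, 1, M.one_mem, (mul_one w).symm⟩
    · have : ∃ u ∈ M, ∃ v ∈ M, u ≠ 1 ∧ v ≠ 1 ∧ w = u * v := by
        by_contra hc
        exact hb ⟨hw, h1, hc⟩
      obtain ⟨u, hu, v, hv, hu1, hv1, rfl⟩ := this
      have := length_pos_of_ne_one hv1
      rw [FreeMonoid.length_mul] at hn
      obtain ⟨b, hbM, h, hh, rfl⟩ := ih u.length (by omega) u rfl hu hu1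
      exact ⟨b, hbM, h * v, M.mul_mem hh hv, mul_assoc _ _ _⟩

theorem le_closure_minGen (M : Submonoid (FreeMonoid A)) : M ≤ Submonoid.closure (minGen M) := by
  have key : ∀ (n : ℕ) (w : FreeMonoid A), w.length = n → w ∈ M →
      w ∈ Submonoid.closure (minGen M) := by
    intro n
    induction n using Nat.strong_induction_on with
    | _ n ih =>
      intro w hn hw
      by_cases h1 : w = 1
      · exact h1 ▸ Submonoid.one_mem _
      · obtain ⟨b, hb, h, hh, rfl⟩ := exists_minGen_mul _ w rfl hw h1
        have := length_pos_of_ne_one hb.2.1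
        rw [FreeMonoid.length_mul] at hn
        exact Submonoid.mul_mem _ (Submonoid.subset_closure hb) (ih h.length (by omega) h rfl hh)
  exact fun w hw => key _ w rfl hw

end Words

/-! ### Stable submonoids and the free hull -/

section Hull

variable {A : Type*}

/-- Schützenberger's stability condition for submonoids of the free monoid. -/
def IsStable (M : Submonoid (FreeMonoid A)) : Prop :=
  ∀ u v w : FreeMonoid A, u ∈ M → v ∈ M → u * w ∈ M → w * v ∈ M → w ∈ M

/-- The free hull of a set of words: the least stable submonoid that contains it. -/
def hull (S : Set (FreeMonoid A)) : Submonoid (FreeMonoid A) :=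
  sInf {M | S ⊆ M ∧ IsStable M}

theorem subset_hull (S : Set (FreeMonoid A)) : S ⊆ hull S :=
  fun _ hx => Submonoid.mem_sInf.2 fun _ hM => hM.1 hx

theorem hull_le {S : Set (FreeMonoid A)} {M : Submonoid (FreeMonoid A)} (h : S ⊆ M)
    (hM : IsStable M) : hull S ≤ M :=
  sInf_le ⟨h, hM⟩

theorem isStable_hull (S : Set (FreeMonoid A)) : IsStable (hull S) :=
  fun u v w hu hv huw hwv => Submonoid.mem_sInf.2 fun _ hM =>
    hM.2 u v w (hull_le hM.1 hM.2 hu) (hull_le hM.1 hM.2 hv) (hull_le hM.1 hM.2 huw)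
      (hull_le hM.1 hM.2 hwv)

/-- If `c = b * r`, then `h = r * k`, so stability puts `r` in `M` and minimality of `c` forces `r =
1`. This uniqueness of the first factor is all the freeness needed from the hull. -/
theorem IsStable.minGen_eq {M : Submonoid (FreeMonoid A)} (hM : IsStable M)
    {b c h k : FreeMonoid A} (hb : b ∈ minGen M) (hc : c ∈ minGen M) (hh : h ∈ M) (hk : k ∈ M)
    (e : b * h = c * k) : b = c := by
  wlog hl : b.length ≤ c.length generalizing b c h k
  · exact (this hc hb hk hh e.symm (by omega)).symm
  obtain ⟨r, rfl, rfl⟩ := exists_eq_mul_of_mul_eq_mul e hl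
  have hr : r ∈ M := hM b k r hb.1 hk hc.1 hh
  by_contra hne
  exact hc.2.2 ⟨b, hb.1, r, hr, hb.2.1, fun h1 => hne (by rw [h1, mul_one]), rfl⟩

/-- The words of a stable submonoid whose factorization does not begin with `b`. -/
def notBeginningWith {M : Submonoid (FreeMonoid A)} (hM : IsStable M) {b : FreeMonoid A}
    (hb : b ∈ minGen M) : Submonoid (FreeMonoid A) where
  carrier := {w | w ∈ M ∧ ¬ ∃ h ∈ M, w = b * h}
  one_mem' := by
    refine ⟨M.one_mem, ?_⟩
    rintro ⟨h, -, e⟩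
    have := congrArg FreeMonoid.length e
    have hp := length_pos_of_ne_one hb.2.1
    rw [FreeMonoid.length_mul, FreeMonoid.length_one] at this
    omega
  mul_mem' := by
    rintro u v ⟨hu, hu'⟩ ⟨hv, hv'⟩
    refine ⟨M.mul_mem hu hv, ?_⟩
    rintro ⟨h, hh, e⟩
    by_cases hu1 : u = 1
    · exact hv' ⟨h, hh, by rw [← e, hu1, one_mul]⟩
    · obtain ⟨c, hc, k, hk, rfl⟩ := exists_minGen_mul _ u rfl hu hu1
      rw [mul_assoc] at e
      have := hM.minGen_eq hc hb (M.mul_mem hk hv) hh e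
      exact hu' ⟨k, hk, by rw [this]⟩

theorem isStable_notBeginningWith {M : Submonoid (FreeMonoid A)} (hM : IsStable M)
    {b : FreeMonoid A} (hb : b ∈ minGen M) : IsStable (notBeginningWith hM hb) := by
  rintro u v w hu hv huw hwv
  refine ⟨hM u v w hu.1 hv.1 huw.1 hwv.1, ?_⟩
  rintro ⟨h, hh, rfl⟩
  exact hwv.2 ⟨h * v, M.mul_mem hh hv.1, mul_assoc _ _ _⟩

/-- Every minimal generator of the free hull of `S` begins some word of `S`. -/
theorem exists_mem_eq_minGen_mul {S : Set (FreeMonoid A)} {b : FreeMonoid A}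
    (hb : b ∈ minGen (hull S)) : ∃ x ∈ S, ∃ h ∈ hull S, x = b * h := by
  by_contra hc
  -- Otherwise the words not beginning with `b` form a stable submonoid containing `S` but not `b`,
  -- against minimality of the hull.
  have hle : hull S ≤ notBeginningWith (isStable_hull S) hb :=
    hull_le (fun x hx => ⟨subset_hull S hx, fun ⟨h, hh, e⟩ => hc ⟨x, hx, h, hh, e⟩⟩)
      (isStable_notBeginningWith _ hb)
  exact (hle hb.1).2 ⟨1, Submonoid.one_mem _, (mul_one b).symm⟩

end Hull

/-! ### Words of equal length: freeness is automatic -/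

section Uniform

variable {A : Type*} {X : Set (FreeMonoid A)} {n : ℕ}

theorem le_length_of_mem_closure (hX : ∀ x ∈ X, x.length = n) {w : FreeMonoid A}
    (hw : w ∈ Submonoid.closure X) (h1 : w ≠ 1) : n ≤ w.length := by
  obtain ⟨g, hg, -, h, -, rfl⟩ := exists_mul_of_mem_closure hw h1
  rw [FreeMonoid.length_mul, hX g hg]
  omega

theorem minGen_closure_of_uniform (hn : 0 < n) (hX : ∀ x ∈ X, x.length = n) :
    minGen (Submonoid.closure X) = X := by
  ext x
  constructor
  · rintro ⟨hx, h1, hu⟩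
    obtain ⟨g, hg, hg1, h, hh, rfl⟩ := exists_mul_of_mem_closure hx h1
    by_cases hh1 : h = 1
    · rwa [hh1, mul_one]
    · exact absurd ⟨g, Submonoid.subset_closure hg, h, hh, hg1, hh1, rfl⟩ hu
  · intro hx
    refine ⟨Submonoid.subset_closure hx, ?_, ?_⟩
    · rintro rfl
      have := hX 1 hx
      rw [FreeMonoid.length_one] at this
      omega
    · rintro ⟨u, hu, v, hv, hu1, hv1, rfl⟩
      have h1 := le_length_of_mem_closure hX hu hu1
      have h2 := le_length_of_mem_closure hX hv hv1
      have h3 := hX _ hx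
      rw [FreeMonoid.length_mul] at h3
      omega

theorem list_eq_of_prod_eq_of_uniform (hn : 0 < n) (hX : ∀ x ∈ X, x.length = n) :
    ∀ l l' : List (FreeMonoid A), (∀ x ∈ l, x ∈ X) → (∀ x ∈ l', x ∈ X) → l.prod = l'.prod →
      l = l' := by
  intro l
  induction l with
  | nil =>
    rintro (_ | ⟨a, l'⟩) - h' e
    · rfl
    · have h1 := congrArg FreeMonoid.length e
      have h2 := hX a (h' a (by simp))
      rw [List.prod_nil, List.prod_cons, FreeMonoid.length_mul, FreeMonoid.length_one] at h1
      omega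
  | cons b l ih =>
    rintro (_ | ⟨a, l'⟩) h h' e
    · have h1 := congrArg FreeMonoid.length e
      have h2 := hX b (h b (by simp))
      rw [List.prod_nil, List.prod_cons, FreeMonoid.length_mul, FreeMonoid.length_one] at h1
      omega
    · rw [List.prod_cons, List.prod_cons] at e
      obtain ⟨rfl, e'⟩ := eq_and_eq_of_mul_eq_mul e
        ((hX b (h b (by simp))).trans (hX a (h' a (by simp))).symm)
      rw [ih l' (fun x hx => h x (by simp [hx])) (fun x hx => h' x (by simp [hx])) e']

theorem isBasisOf_closure_of_uniform (hn : 0 < n) (hX : ∀ x ∈ X, x.length = n) :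
    IsBasisOf X (Submonoid.closure X) := by
  have hm := minGen_closure_of_uniform hn hX
  refine ⟨fun w hw => ?_, hm.symm⟩
  rw [hm]
  obtain ⟨l, hl, e⟩ := Submonoid.exists_list_of_mem_closure hw
  exact ⟨l, ⟨hl, e⟩, fun l' h' =>
    list_eq_of_prod_eq_of_uniform hn hX l' l h'.1 hl (h'.2.trans e.symm)⟩

end Uniform

/-! ### θ-powers, θ-roots and maximality -/

section Theta

variable {A : Type*} {θ : FreeMonoid A →* FreeMonoid A}

theorem IsInvolutive.apply_apply (hθ : IsInvolutive θ) (w : FreeMonoid A) : θ (θ w) = w := by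
  have : θ.comp θ = MonoidHom.id _ := FreeMonoid.hom_eq hθ
  exact DFunLike.congr_fun this w

theorem IsInvolutive.ne_one (hθ : IsInvolutive θ) {w : FreeMonoid A} (hw : w ≠ 1) : θ w ≠ 1 :=
  fun h => hw (by rw [← hθ.apply_apply w, h, map_one])

/-- No letter is erased, so `θ` never shortens a word; apply this to `w` and to `θ w`. -/
theorem IsInvolutive.length_apply (hθ : IsInvolutive θ) (w : FreeMonoid A) :
    (θ w).length = w.length := by
  have key : ∀ w : FreeMonoid A, w.length ≤ (θ w).length := by
    intro w
    induction w using FreeMonoid.inductionOn' with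
    | one => simp
    | of_mul a w ih =>
      have := length_pos_of_ne_one (hθ.ne_one (FreeMonoid.of_ne_one a))
      rw [map_mul, FreeMonoid.length_mul, FreeMonoid.length_mul, FreeMonoid.length_of]
      omega
  have h1 := key (θ w)
  rw [hθ.apply_apply] at h1
  exact le_antisymm h1 (key w)

theorem IsInvolutive.mem_closure (hθ : IsInvolutive θ) {p w : FreeMonoid A}
    (hw : w ∈ Submonoid.closure {p, θ p}) : θ w ∈ Submonoid.closure {p, θ p} := by
  have : Submonoid.closure {p, θ p} ≤ (Submonoid.closure {p, θ p}).comap θ := by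
    rw [Submonoid.closure_le]
    rintro x (rfl | rfl)
    · exact Submonoid.subset_closure (by simp)
    · exact Submonoid.subset_closure (by simp [hθ.apply_apply])
  exact this hw

theorem IsInvolutive.closure_pair_le (hθ : IsInvolutive θ) {p w : FreeMonoid A}
    (hw : w ∈ Submonoid.closure {p, θ p}) :
    Submonoid.closure {w, θ w} ≤ Submonoid.closure {p, θ p} := by
  rw [Submonoid.closure_le]
  rintro x (rfl | rfl)
  · exact hw
  · exact hθ.mem_closure hw

theorem IsThetaPower.mem_closure {w t : FreeMonoid A} (h : IsThetaPower θ w t) :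
    w ∈ Submonoid.closure {t, θ t} := by
  obtain ⟨s, hs, rfl⟩ := h
  exact Submonoid.mul_mem _ (Submonoid.subset_closure (by simp)) hs

theorem IsThetaPower.trans (hθ : IsInvolutive θ) {w t u : FreeMonoid A}
    (h : IsThetaPower θ w t) (h' : IsThetaPower θ t u) : IsThetaPower θ w u := by
  have ht := h'.mem_closure
  obtain ⟨s, hs, rfl⟩ := h
  obtain ⟨r, hr, rfl⟩ := h'
  exact ⟨r * s, Submonoid.mul_mem _ hr (hθ.closure_pair_le ht hs), mul_assoc _ _ _⟩

theorem IsThetaPower.ne_one {w t : FreeMonoid A} (h : IsThetaPower θ w t) (hw : w ≠ 1) :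
    t ≠ 1 := by
  rintro rfl
  obtain ⟨s, hs, rfl⟩ := h
  rw [map_one, Set.pair_eq_singleton, Submonoid.closure_singleton_one, Submonoid.mem_bot] at hs
  exact hw hs

theorem IsThetaPrimitive.eq_of_isThetaPower {w t : FreeMonoid A} (hw : IsThetaPrimitive θ w)
    (h : IsThetaPower θ w t) : w = t := by
  by_cases h1 : w = 1
  · subst h1
    obtain ⟨s, -, e⟩ := h
    have := congrArg FreeMonoid.length e
    rw [FreeMonoid.length_mul, FreeMonoid.length_one] at this
    exact (FreeMonoid.length_eq_zero.1 (by omega)).symm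
  · have hl : ¬ t.length < w.length := fun hl => hw ⟨t, h.ne_one h1, h, hl⟩
    obtain ⟨s, -, rfl⟩ := h
    rw [FreeMonoid.length_mul] at hl
    have hs : s = 1 := FreeMonoid.length_eq_zero.1 (by omega)
    rw [hs, mul_one]

theorem IsInvolutive.map_minGen (hθ : IsInvolutive θ) {M : Submonoid (FreeMonoid A)}
    (hM : ∀ w ∈ M, θ w ∈ M) {b : FreeMonoid A} (hb : b ∈ minGen M) : θ b ∈ minGen M := by
  refine ⟨hM b hb.1, hθ.ne_one hb.2.1, ?_⟩
  rintro ⟨u, hu, v, hv, hu1, hv1, e⟩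
  refine hb.2.2 ⟨θ u, hM u hu, θ v, hM v hv, hθ.ne_one hu1, hθ.ne_one hv1, ?_⟩
  rw [← map_mul, ← e, hθ.apply_apply]

/-- Two nonempty words that satisfy a relation beginning with `x` on one side and with `y` on the
other are `θ`-powers of a common word. -/
theorem exists_common_isThetaPower (hθ : IsInvolutive θ) {x y s t : FreeMonoid A} (hx : x ≠ 1)
    (hy : y ≠ 1) (hs : s ∈ Submonoid.closure {x, θ x, y, θ y})
    (ht : t ∈ Submonoid.closure {x, θ x, y, θ y}) (e : x * s = y * t) :
    ∃ p, IsThetaPower θ x p ∧ IsThetaPower θ y p := by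
  set S : Set (FreeMonoid A) := {x, θ x, y, θ y} with hS
  have hcl : Submonoid.closure S ≤ hull S := Submonoid.closure_le.2 (subset_hull S)
  -- The preimage of the hull under `θ` is stable and contains `S`.
  have hθH : hull S ≤ (hull S).comap θ := by
    refine hull_le ?_ ?_
    · intro z hz
      refine subset_hull S ?_
      rw [hS] at hz ⊢
      rcases hz with rfl | rfl | rfl | rfl <;> simp [hθ.apply_apply]
    · intro u v w hu hv huw hwv
      rw [Submonoid.mem_comap] at *
      rw [map_mul] at huw hwv
      exact isStable_hull S _ _ _ hu hv huw hwv
  have hstab := isStable_hull S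
  have hxH : x ∈ hull S := subset_hull S (by simp [hS])
  have hyH : y ∈ hull S := subset_hull S (by simp [hS])
  obtain ⟨p, hp, h, hh, ex⟩ := exists_minGen_mul _ x rfl hxH hx
  obtain ⟨q, hq, k, hk, ey⟩ := exists_minGen_mul _ y rfl hyH hy
  have hpq : p = q := by
    refine hstab.minGen_eq hp hq ((hull S).mul_mem hh (hcl hs)) ((hull S).mul_mem hk (hcl ht)) ?_
    rw [← mul_assoc, ← mul_assoc, ← ex, ← ey, e]
  subst hpq
  have hθp := hθ.map_minGen (M := hull S) (fun w hw => hθH hw) hp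
  have hB : minGen (hull S) ⊆ {p, θ p} := by
    intro b hb
    obtain ⟨z, hz, r, hr, ez⟩ := exists_mem_eq_minGen_mul hb
    rw [hS] at hz
    rcases hz with rfl | rfl | rfl | rfl
    · exact Or.inl (hstab.minGen_eq hb hp hr hh (ez.symm.trans ex))
    · refine Or.inr (hstab.minGen_eq hb hθp hr (hθH hh) (ez.symm.trans ?_))
      rw [← map_mul, ← ex]
    · exact Or.inl (hstab.minGen_eq hb hp hr hk (ez.symm.trans ey))
    · refine Or.inr (hstab.minGen_eq hb hθp hr (hθH hk) (ez.symm.trans ?_))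
      rw [← map_mul, ← ey]
  have hH : hull S ≤ Submonoid.closure {p, θ p} :=
    (le_closure_minGen _).trans (Submonoid.closure_mono hB)
  exact ⟨p, ⟨h, hH hh, ex⟩, ⟨k, hH hk, ey⟩⟩

/-- The existence and uniqueness of the `θ`-root. -/
theorem existsUnique_thetaRoot (hθ : IsInvolutive θ) (w : FreeMonoid A) :
    ∃! u, IsThetaPrimitive θ u ∧ IsThetaPower θ w u := by
  have hex : ∀ (n : ℕ) (w : FreeMonoid A), w.length = n →
      ∃ u, IsThetaPrimitive θ u ∧ IsThetaPower θ w u := by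
    intro n
    induction n using Nat.strong_induction_on with
    | _ n ih =>
      intro w hn
      by_cases hw : IsThetaPrimitive θ w
      · exact ⟨w, hw, 1, Submonoid.one_mem _, (mul_one w).symm⟩
      · obtain ⟨t, -, ht, hl⟩ := not_not.1 hw
        obtain ⟨u, hu, htu⟩ := ih t.length (by omega) t rfl
        exact ⟨u, hu, ht.trans hθ htu⟩
  obtain ⟨u, hu, hwu⟩ := hex _ w rfl
  refine ⟨u, ⟨hu, hwu⟩, ?_⟩
  rintro v ⟨hv, hwv⟩
  by_cases h1 : w = 1
  · have h0 : ∀ z, IsThetaPower θ w z → z = 1 := by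
      rintro z ⟨s, -, e⟩
      have := congrArg FreeMonoid.length e
      rw [h1, FreeMonoid.length_mul, FreeMonoid.length_one] at this
      exact FreeMonoid.length_eq_zero.1 (by omega)
    rw [h0 u hwu, h0 v hwv]
  · have hu1 := hwu.ne_one h1
    have hv1 := hwv.ne_one h1
    obtain ⟨s, hs, e⟩ := hwu
    obtain ⟨t, ht, e'⟩ := hwv
    obtain ⟨p, hpu, hpv⟩ := exists_common_isThetaPower hθ hu1 hv1
      (Submonoid.closure_mono (by intro z hz; rcases hz with rfl | rfl <;> simp) hs)
      (Submonoid.closure_mono (by intro z hz; rcases hz with rfl | rfl <;> simp) ht)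
      (e.symm.trans e')
    rw [hu.eq_of_isThetaPower hpu, hv.eq_of_isThetaPower hpv]

/-- The word `w` begins with `p` or `θ p`, so it is a θ-power of that word and equals it. -/
theorem IsThetaPrimitive.closure_eq (hθ : IsInvolutive θ) {w p : FreeMonoid A} (hw1 : w ≠ 1)
    (hw : IsThetaPrimitive θ w) (hp : w ∈ Submonoid.closure {p, θ p}) :
    Submonoid.closure {w, θ w} = Submonoid.closure {p, θ p} := by
  obtain ⟨g, hg, -, h, hh, e⟩ := exists_mul_of_mem_closure hp hw1
  rcases hg with rfl | rfl
  · rw [hw.eq_of_isThetaPower ⟨h, hh, e⟩]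
  · have : w = θ p := hw.eq_of_isThetaPower
      ⟨h, by rwa [hθ.apply_apply, Set.pair_comm], e⟩
    rw [this, hθ.apply_apply, Set.pair_comm]

/-- A word of `Y*` whose `θ`-image is another word of `Y*` yields a relation between two different
generators. -/
theorem exists_relation (hθ : IsInvolutive θ) {Y : Set (FreeMonoid A)} :
    ∀ (n : ℕ) (u v : FreeMonoid A), u.length = n → u ∈ Submonoid.closure Y →
      v ∈ Submonoid.closure Y → u = θ v → u ≠ v →
      ∃ x ∈ Y, ∃ y ∈ Y, x ≠ y ∧ ∃ s ∈ Submonoid.closure Y, ∃ t ∈ Submonoid.closure Y,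
        x * s = θ y * θ t := by
  intro n
  induction n using Nat.strong_induction_on with
  | _ n ih =>
    intro u v hn hu hv e hne
    have hv1 : v ≠ 1 := fun h => hne (by rw [e, h, map_one])
    have hu1 : u ≠ 1 := e ▸ hθ.ne_one hv1
    obtain ⟨x, hx, hx1, s, hs, rfl⟩ := exists_mul_of_mem_closure hu hu1
    obtain ⟨y, hy, -, t, ht, rfl⟩ := exists_mul_of_mem_closure hv hv1
    rw [map_mul] at e
    by_cases hxy : x = y
    · subst hxy
      obtain ⟨-, e2⟩ := eq_and_eq_of_mul_eq_mul e (hθ.length_apply x).symm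
      have := length_pos_of_ne_one hx1
      rw [FreeMonoid.length_mul] at hn
      exact ih s.length (by omega) s t rfl hs ht e2 (fun h => hne (by rw [h]))
    · exact ⟨x, hx, y, hy, hxy, s, hs, t, ht, e⟩

theorem ncard_pair_le (x y : FreeMonoid A) : ({x, y} : Set (FreeMonoid A)).ncard ≤ 2 :=
  (Set.ncard_insert_le _ _).trans (by rw [Set.ncard_singleton])

theorem uniform_pair (hθ : IsInvolutive θ) (w : FreeMonoid A) :
    ∀ x ∈ ({w, θ w} : Set (FreeMonoid A)), x.length = w.length := by
  rintro x (rfl | rfl)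
  · rfl
  · exact hθ.length_apply w

theorem IsThetaPrimitive.eq_of_le_closure (hθ : IsInvolutive θ) {w : FreeMonoid A} (hw1 : w ≠ 1)
    (hw : IsThetaPrimitive θ w) {Y : Set (FreeMonoid A)} (hfin : Y.Finite)
    (hY : Y.ncard ≤ ({w, θ w} : Set (FreeMonoid A)).ncard) (h1 : (1 : FreeMonoid A) ∉ Y)
    (hle : Submonoid.closure {w, θ w} ≤ Submonoid.closure Y) :
    Submonoid.closure {w, θ w} = Submonoid.closure Y := by
  have hwY : w ∈ Submonoid.closure Y := hle (Submonoid.subset_closure (by simp))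
  have hθwY : θ w ∈ Submonoid.closure Y := hle (Submonoid.subset_closure (by simp))
  by_cases hθw : θ w = w
  · rw [hθw, Set.pair_eq_singleton, Set.ncard_singleton] at hY
    obtain ⟨g, hg, -, h, hh, e⟩ := exists_mul_of_mem_closure hwY hw1
    have hYg : Y = {g} := (Set.eq_of_subset_of_ncard_le (Set.singleton_subset_iff.2 hg)
      (by rwa [Set.ncard_singleton]) hfin).symm
    subst hYg
    have hgw : w = g := hw.eq_of_isThetaPower
      ⟨h, Submonoid.closure_mono (by simp) hh, e⟩
    rw [hθw, Set.pair_eq_singleton, hgw]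
  · refine le_antisymm hle ?_
    obtain ⟨x, hx, y, hy, hxy, s, hs, t, ht, e⟩ :=
      exists_relation hθ _ w (θ w) rfl hwY hθwY (hθ.apply_apply w).symm (Ne.symm hθw)
    have hYxy : Y = {x, y} := by
      refine (Set.eq_of_subset_of_ncard_le ?_ ?_ hfin).symm
      · rintro z (rfl | rfl) <;> assumption
      · rw [Set.ncard_pair hxy]
        exact hY.trans (ncard_pair_le _ _)
    subst hYxy
    have hx1 : x ≠ 1 := fun h => h1 (h ▸ hx)
    have hy1 : y ≠ 1 := fun h => h1 (h ▸ hy)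
    -- The common-root lemma is applied to `x` and `θ y`; since `θ (θ y) = y`, its alphabet contains
    -- all four words.
    have hsub : Submonoid.closure {x, y} ≤
        Submonoid.closure ({x, θ x, θ y, θ (θ y)} : Set (FreeMonoid A)) := by
      refine Submonoid.closure_mono ?_
      rintro z (rfl | rfl) <;> simp [hθ.apply_apply]
    have hθsub : Submonoid.closure {x, y} ≤
        (Submonoid.closure ({x, θ x, θ y, θ (θ y)} : Set (FreeMonoid A))).comap θ := by
      rw [Submonoid.closure_le]
      rintro z (rfl | rfl) <;> exact Submonoid.subset_closure (by simp)
    obtain ⟨p, hpx, hpy⟩ := exists_common_isThetaPower hθ hx1 (hθ.ne_one hy1) (hsub hs)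
      (hθsub ht) e
    have hYp : Submonoid.closure {x, y} ≤ Submonoid.closure {p, θ p} := by
      rw [Submonoid.closure_le]
      rintro z (rfl | rfl)
      · exact hpx.mem_closure
      · have := hθ.mem_closure hpy.mem_closure
        rwa [hθ.apply_apply] at this
    rwa [hw.closure_eq hθ hw1 (hYp hwY)]

theorem isThetaPrimitive_iff_isPrimitiveSet (hθ : IsInvolutive θ) {w : FreeMonoid A}
    (hw1 : w ≠ 1) : IsThetaPrimitive θ w ↔ IsPrimitiveSet {w, θ w} := by
  have hfin : ∀ z : FreeMonoid A, ({z, θ z} : Set (FreeMonoid A)).Finite := fun z =>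
    Set.toFinite _
  have hnot : ∀ z : FreeMonoid A, z ≠ 1 → (1 : FreeMonoid A) ∉ ({z, θ z} : Set _) := by
    rintro z hz (h | h)
    · exact hz h.symm
    · exact hθ.ne_one hz (Set.mem_singleton_iff.1 h).symm
  constructor
  · intro hw
    refine ⟨hfin w, Submonoid.closure {w, θ w}, ⟨⟨_, hfin w, le_rfl, hnot w hw1, rfl⟩, ?_⟩,
      isBasisOf_closure_of_uniform (length_pos_of_ne_one hw1) (uniform_pair hθ w)⟩
    rintro _ ⟨Y, hYfin, hY, h1, rfl⟩ hle
    exact hw.eq_of_le_closure hθ hw1 hYfin hY h1 hle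
  · rintro ⟨-, M, ⟨-, hmax⟩, hfree, hbasis⟩ ⟨t, ht1, ht, hl⟩
    have hM : M ≤ Submonoid.closure {w, θ w} := by
      rw [hbasis]
      exact le_closure_minGen M
    have hcard : ({t, θ t} : Set (FreeMonoid A)).ncard ≤
        ({w, θ w} : Set (FreeMonoid A)).ncard := by
      -- If `w` is fixed by `θ`, so is its prefix `t`, and both sets are singletons.
      by_cases hθw : θ w = w
      · obtain ⟨s, -, e⟩ := ht
        have e' : θ t * θ s = t * s := by rw [← map_mul, ← e, hθw]
        rw [(eq_and_eq_of_mul_eq_mul e' (hθ.length_apply t)).1, hθw, Set.pair_eq_singleton,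
          Set.pair_eq_singleton, Set.ncard_singleton, Set.ncard_singleton]
      · rw [Set.ncard_pair (Ne.symm hθw)]
        exact ncard_pair_le _ _
    have heq := hmax (Submonoid.closure {t, θ t}) ⟨_, hfin t, hcard, hnot t ht1, rfl⟩
      (hM.trans (hθ.closure_pair_le ht.mem_closure))
    have htw : t ∈ Submonoid.closure {w, θ w} :=
      hM (heq ▸ Submonoid.subset_closure (by simp))
    -- Nonempty words of `{w, θ w}*` have length at least `|w|`, but `t` is shorter.
    exact absurd (le_length_of_mem_closure (uniform_pair hθ w) htw ht1) (by omega)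

end Theta

end WordComb

theorem mainTheorem6 {A : Type*} (θ : FreeMonoid A →* FreeMonoid A)
    (hθ : WordComb.IsInvolutive θ) :
    (∀ w : FreeMonoid A, w ≠ 1 →
      (WordComb.IsThetaPrimitive θ w ↔
        WordComb.IsPrimitiveSet ({w, θ w} : Set (FreeMonoid A)))) ∧
    (∀ w : FreeMonoid A, θ w ≠ w →
      (WordComb.IsThetaPrimitive θ w ↔
        WordComb.IsPrimitivePair ({w, θ w} : Set (FreeMonoid A)))) ∧
    (∀ w : FreeMonoid A, ∃! u : FreeMonoid A,
      WordComb.IsThetaPrimitive θ u ∧ WordComb.IsThetaPower θ w u) := by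
  refine ⟨fun w hw => WordComb.isThetaPrimitive_iff_isPrimitiveSet hθ hw, fun w hw => ?_,
    WordComb.existsUnique_thetaRoot hθ⟩
  have hw1 : w ≠ 1 := fun h => hw (by rw [h, map_one])
  rw [WordComb.isThetaPrimitive_iff_isPrimitiveSet hθ hw1]
  exact ⟨fun h => ⟨h, Set.ncard_pair (Ne.symm hw)⟩, fun h => h.1⟩
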